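/- Let $K$ be a compact Hausdorff space, $C(K)$ the algebra of real continuous functions on $K$, and let $F$ be a (real) Banach lattice with a quasi-interior point $u\ge 0$ (that is, the closed ideal generated by $u$ is $F$) whose ideal center $Z(F)=\{S : F\to F \text{ bounded linear} : \exists \lambda>0,\ |Sx|\le\lambda x \text{ for all } x\ge 0\}$ is identified with $C(K)$, both as an algebra and as a Banach lattice. Through this identification $C(K)$ acts on $F$, and a function $a\in C(K)$ is regarded as the element $au$ of $F$. Let $X$ be a real Banach space with dual $X^*$. For $f$ in the space $C(K,X)$ of continuous functions $K\to X$ let $|f|_X\in C(K)$ be the function $t\mapsto\|f(t)\|$, and let $F_\pi(X)$ be the completion of $C(K,X)$ in the norm $\|f\|_{F(X)}=\|\,|f|_X u\|_F$, with the action of $C(K)$ that extends the pointwise product by continuity. For $x\in X$ let $\vec x\in C(K,X)$ be the constant function with value $x$. For $x^*\in X^*$ let $f\mapsto\langle f,x^*\rangle$ be the bounded linear map $F_\pi(X)\to F$ extending by continuity the map that sends $f\in C(K,X)$ to $bu$, where $b(t)=\langle f(t),x^*\rangle$; and for $x\in X$ let $\varphi\mapsto\varphi\vec x$ be the bounded linear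 map $F\to F_\pi(X)$ extending by continuity the map $au\mapsto a\vec x$, $a\in C(K)$ (recall that $\{au : a\in C(K)\}$ is dense in $F$). Let $T$ be a bounded linear operator on $F_\pi(X)$. Then the following are equivalent: (i) $T$ is a multiplication operator, i.e. there is $a\in C(K)$ with $T(f)=af$ for all $f\in F_\pi(X)$; (iii) the equality $T(a\langle f,x^*\rangle\vec x)=a\langle T(f),x^*\rangle\vec x$ holds for all $a\in C(K)$, $f\in F_\pi(X)$, $x\in X$ and $x^*\in X^*$. -/

import Mathlib

noncomputable section

namespace FPi

open UniformSpace

section Center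

variable (F : Type*) [NormedAddCommGroup F] [NormedSpace ℝ F] [Lattice F]
  [IsOrderedAddMonoid F]

/-- `T` is central: for some `l > 0`, `|T x| ≤ l x` for each non-negative `x`. -/
def IsCentral {F : Type*} [NormedAddCommGroup F] [NormedSpace ℝ F] [Lattice F]
    (T : F →L[ℝ] F) : Prop :=
  ∃ l : ℝ, 0 < l ∧ ∀ x : F, 0 ≤ x → |T x| ≤ l • x

variable {F} in
theorem IsCentral.exists_abs_le [IsOrderedModule ℝ F] {T : F →L[ℝ] F} (h : IsCentral T) :
    ∃ l : ℝ, 0 < l ∧ ∀ x : F, |T x| ≤ l • |x| := by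
  obtain ⟨l, hl, H⟩ := h
  refine ⟨l, hl, fun x => ?_⟩
  have h1 : T x = T x⁺ - T x⁻ := by rw [← map_sub, posPart_sub_negPart]
  have h2 : |T x⁺ - T x⁻| ≤ |T x⁺| + |T x⁻| := by
    rw [sub_eq_add_neg]
    refine (abs_add_le _ _).trans ?_
    rw [abs_neg]
  rw [h1, ← posPart_add_negPart x, smul_add]
  exact h2.trans (add_le_add (H _ (posPart_nonneg x)) (H _ (negPart_nonneg x)))

/-- The ideal center `Z(F)` of a Banach lattice, an algebra of bounded operators on `F`. -/
def idealCenter [IsOrderedModule ℝ F] : Subalgebra ℝ (F →L[ℝ] F) where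
  carrier := {T | IsCentral T}
  mul_mem' := by
    rintro S T hS ⟨m, hm, hT⟩
    obtain ⟨l, hl, hS⟩ := hS.exists_abs_le
    refine ⟨l * m, mul_pos hl hm, fun x hx => ?_⟩
    rw [mul_smul]
    exact (hS (T x)).trans (smul_le_smul_of_nonneg_left (hT x hx) hl.le)
  add_mem' := by
    rintro S T ⟨l, hl, hS⟩ ⟨m, hm, hT⟩
    refine ⟨l + m, add_pos hl hm, fun x hx => ?_⟩
    rw [add_smul]
    exact (abs_add_le (S x) (T x)).trans (add_le_add (hS x hx) (hT x hx))
  algebraMap_mem' := by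
    intro r
    refine ⟨|r| + 1, by positivity, fun x hx => ?_⟩
    have e : (algebraMap ℝ (F →L[ℝ] F) r) x = r • x := by
      simp [Algebra.algebraMap_eq_smul_one]
    rw [e]
    have hp : r • x ≤ (|r| + 1) • x :=
      smul_le_smul_of_nonneg_right (by linarith [le_abs_self r]) hx
    have hn : -(r • x) ≤ (|r| + 1) • x := by
      rw [← neg_smul]
      exact smul_le_smul_of_nonneg_right (by linarith [neg_abs_le r]) hx
    exact sup_le hp hn

/-- A quasi-interior point of `F`: an element `u ≥ 0` such that the closed (order) ideal generated
by `u`, i.e. the closure of `{y | |y| ≤ c u for some real c}`, is all of `F`. -/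
structure QuasiInteriorPoint where
  /-- the point itself -/
  val : F
  nonneg : 0 ≤ val
  dense : Dense {y : F | ∃ c : ℝ, |y| ≤ c • val}

/-- An identification `Z(F) = C(K)`, both as an algebra and as a Banach lattice (`Z(F)` carries
the operator order and the operator norm). -/
structure CenterIso (K : Type*) [TopologicalSpace K] [CompactSpace K]
    (F : Type*) [NormedAddCommGroup F] [NormedSpace ℝ F] [Lattice F]
    [IsOrderedAddMonoid F] [IsOrderedModule ℝ F] where
  /-- the isomorphism of algebras -/
  toAlgEquiv : C(K, ℝ) ≃ₐ[ℝ] idealCenter F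
  nonneg_iff : ∀ a : C(K, ℝ), 0 ≤ a ↔ ∀ x : F, 0 ≤ x → 0 ≤ (toAlgEquiv a : F →L[ℝ] F) x
  norm_map : ∀ a : C(K, ℝ), ‖(toAlgEquiv a : F →L[ℝ] F)‖ = ‖a‖

end Center

section Space

variable {K : Type*} [TopologicalSpace K] [CompactSpace K]
  {F : Type*} [NormedAddCommGroup F] [NormedSpace ℝ F] [Lattice F]
  [IsOrderedAddMonoid F] [IsOrderedModule ℝ F]

/-- The action of `a ∈ C(K) = Z(F)` on `F`. -/
def CenterIso.act (Φ : CenterIso K F) (a : C(K, ℝ)) : F →L[ℝ] F := Φ.toAlgEquiv a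

/-- The element `a u` of `F`; with `u` replaced by `1`, this is the function `a ∈ C(K) ⊆ F`. -/
def emb (Φ : CenterIso K F) (u : QuasiInteriorPoint F) : C(K, ℝ) →ₗ[ℝ] F where
  toFun a := Φ.act a u.val
  map_add' a b := by simp [CenterIso.act]
  map_smul' r a := by simp [CenterIso.act]

theorem emb_nonneg (Φ : CenterIso K F) (u : QuasiInteriorPoint F) {a : C(K, ℝ)} (ha : 0 ≤ a) :
    0 ≤ emb Φ u a :=
  (Φ.nonneg_iff a).1 ha u.val u.nonneg

theorem emb_mono (Φ : CenterIso K F) (u : QuasiInteriorPoint F) {a b : C(K, ℝ)} (h : a ≤ b) :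
    emb Φ u a ≤ emb Φ u b := by
  have := emb_nonneg Φ u (sub_nonneg.2 h)
  rwa [map_sub, sub_nonneg] at this

theorem norm_emb_mono [HasSolidNorm F] (Φ : CenterIso K F) (u : QuasiInteriorPoint F)
    {a b : C(K, ℝ)} (ha : 0 ≤ a) (h : a ≤ b) : ‖emb Φ u a‖ ≤ ‖emb Φ u b‖ := by
  apply norm_le_norm_of_abs_le_abs
  rw [abs_of_nonneg (emb_nonneg Φ u ha), abs_of_nonneg (emb_nonneg Φ u (ha.trans h))]
  exact emb_mono Φ u h

theorem norm_emb_abs_le [HasSolidNorm F] (Φ : CenterIso K F) (u : QuasiInteriorPoint F)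
    (a : C(K, ℝ)) : ‖emb Φ u a‖ ≤ ‖emb Φ u |a|‖ := by
  apply norm_le_norm_of_abs_le_abs
  rw [abs_of_nonneg (emb_nonneg Φ u (abs_nonneg a))]
  refine sup_le (emb_mono Φ u (le_abs_self a)) ?_
  rw [← map_neg]
  exact emb_mono Φ u (neg_le_abs a)

variable {X : Type*} [NormedAddCommGroup X] [NormedSpace ℝ X]

/-- The norm function `|f|_X ∈ C(K)`, `t ↦ ‖f t‖`. -/
def normFun (f : C(K, X)) : C(K, ℝ) := ⟨fun t => ‖f t‖, f.continuous.norm⟩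

/-- The constant function with value `x`. -/
def const (K : Type*) [TopologicalSpace K] (x : X) : C(K, X) := ContinuousMap.const K x

/-- The function `⟨f, x*⟩ ∈ C(K)`, `t ↦ ⟨f t, x*⟩`. -/
def pairC (xs : X →L[ℝ] ℝ) (f : C(K, X)) : C(K, ℝ) := ⟨fun t => xs (f t), by fun_prop⟩

/-- The vector space `C(K, X)`, to be equipped with the norm `‖f‖ = ‖ |f|_X ‖_F`. -/
def CFX (_Φ : CenterIso K F) (_u : QuasiInteriorPoint F) (X : Type*)
    [NormedAddCommGroup X] [NormedSpace ℝ X] : Type _ := C(K, X)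

variable (Φ : CenterIso K F) (u : QuasiInteriorPoint F)

instance : AddCommGroup (CFX Φ u X) := inferInstanceAs (AddCommGroup C(K, X))
instance : Module ℝ (CFX Φ u X) := inferInstanceAs (Module ℝ C(K, X))
/-- The pointwise product `a f` of `a ∈ C(K)` and `f ∈ C(K, X)`. -/
instance : Module C(K, ℝ) (CFX Φ u X) := inferInstanceAs (Module C(K, ℝ) C(K, X))

/-- `f ∈ C(K, X)` as an element of the renormed space. -/
def toCFX : C(K, X) ≃ₗ[ℝ] CFX Φ u X := LinearEquiv.refl ℝ C(K, X)

variable [HasSolidNorm F]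

/-- The norm `‖f‖ = ‖ |f|_X ‖_F` on `C(K, X)`. -/
def seminormF : AddGroupSeminorm (CFX Φ u X) where
  toFun f := ‖emb Φ u (normFun ((toCFX Φ u).symm f))‖
  map_zero' := by
    have : normFun ((toCFX Φ u).symm (0 : CFX Φ u X)) = 0 := by ext t; simp [normFun]
    rw [this]; simp
  add_le' f g := by
    refine le_trans ?_ (norm_add_le _ _)
    rw [← map_add (emb Φ u)]
    refine norm_emb_mono Φ u (fun t => norm_nonneg _) fun t => ?_
    simpa [normFun] using norm_add_le _ _
  neg' f := by
    have : normFun ((toCFX Φ u).symm (-f)) = normFun ((toCFX Φ u).symm f) := by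
      ext t; simp [normFun]
    rw [this]

instance : SeminormedAddCommGroup (CFX Φ u X) := (seminormF Φ u).toSeminormedAddCommGroup

theorem norm_toCFX (f : C(K, X)) : ‖toCFX Φ u f‖ = ‖emb Φ u (normFun f)‖ := rfl

instance : NormedSpace ℝ (CFX Φ u X) where
  norm_smul_le r f := by
    obtain ⟨f, rfl⟩ := (toCFX Φ u).surjective f
    rw [← map_smul, norm_toCFX, norm_toCFX]
    have : normFun (r • f) = |r| • normFun f := by ext t; simp [normFun, norm_smul]
    rw [this, map_smul, norm_smul]
    simp

theorem norm_smul_CFX_le (a : C(K, ℝ)) (f : CFX Φ u X) : ‖a • f‖ ≤ ‖a‖ * ‖f‖ := by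
  obtain ⟨f, rfl⟩ := (toCFX Φ u).surjective f
  have h : ‖emb Φ u (normFun (a • f))‖ ≤ ‖emb Φ u (‖a‖ • normFun f)‖ := by
    refine norm_emb_mono Φ u (fun t => norm_nonneg _) fun t => ?_
    have : ‖a t • f t‖ ≤ ‖a‖ * ‖f t‖ := by
      rw [norm_smul]
      exact mul_le_mul_of_nonneg_right (a.norm_coe_le_norm t) (norm_nonneg _)
    simpa [normFun] using this
  rw [map_smul, norm_smul, norm_norm] at h
  exact h

instance : UniformContinuousConstSMul C(K, ℝ) (CFX Φ u X) where
  uniformContinuous_const_smul a :=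
    (AddMonoidHomClass.lipschitz_of_bound (DistribSMul.toAddMonoidHom (CFX Φ u X) a) ‖a‖
      (norm_smul_CFX_le Φ u a)).uniformContinuous

/-- `F_π(X)`, the completion of `C(K, X)` in the norm `‖f‖ = ‖ |f|_X ‖_F`. The action of `C(K)` is
the extension by continuity of the pointwise product. -/
abbrev Space (Φ : CenterIso K F) (u : QuasiInteriorPoint F) (X : Type*)
    [NormedAddCommGroup X] [NormedSpace ℝ X] : Type _ := Completion (CFX Φ u X)

/-- The map `f ↦ ⟨f, x*⟩` from `C(K, X)` with the new norm to `F`. -/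
def pairCFX (xs : X →L[ℝ] ℝ) : CFX Φ u X →L[ℝ] F :=
  LinearMap.mkContinuous
    { toFun := fun f => emb Φ u (pairC xs ((toCFX Φ u).symm f))
      map_add' := fun f g => by
        rw [← map_add]; congr 1; ext t; simp [pairC]
      map_smul' := fun r f => by
        rw [RingHom.id_apply, ← map_smul]; congr 1; ext t; simp [pairC] }
    ‖xs‖ (fun f => by
      obtain ⟨f, rfl⟩ := (toCFX Φ u).surjective f
      rw [norm_toCFX]
      have h := norm_emb_mono Φ u (abs_nonneg (pairC xs f)) (b := ‖xs‖ • normFun f) fun t => by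
        simpa [normFun, pairC] using xs.le_opNorm (f t)
      rw [map_smul, norm_smul, norm_norm] at h
      exact (norm_emb_abs_le Φ u _).trans h)

/-- The map `f ↦ ⟨f, x*⟩` from `F_π(X)` to `F`, extended by continuity from `C(K, X)`. -/
def pairing [CompleteSpace F] (xs : X →L[ℝ] ℝ) : Space Φ u X →L[ℝ] F :=
  (pairCFX Φ u xs).extend Completion.toComplL

/-- The embedding `a ↦ a u` into `F` of `C(K)` with the norm of `F`; it is an isometry. -/
def embF : CFX Φ u ℝ →L[ℝ] F :=
  LinearMap.mkContinuous (emb Φ u ∘ₗ (toCFX Φ u).symm.toLinearMap) 1 (fun f => by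
    rw [one_mul]; exact norm_emb_abs_le Φ u _)

/-- The map `a ↦ a x⃗` from `C(K)` with the norm of `F` to `F_π(X)`. -/
def mulConst (x : X) : CFX Φ u ℝ →L[ℝ] Space Φ u X :=
  Completion.toComplL (𝕜 := ℝ) ∘L LinearMap.mkContinuous
    { toFun := fun a => toCFX Φ u (((toCFX Φ u).symm a : C(K, ℝ)) • const K x)
      map_add' := fun a b => by rw [← map_add, map_add, add_smul]
      map_smul' := fun r a => congrArg (toCFX Φ u) (ContinuousMap.ext fun t =>
        smul_assoc r ((toCFX Φ u).symm a t) x) }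
    ‖x‖ (fun a => by
      obtain ⟨a, rfl⟩ := (toCFX Φ u).surjective a
      have : normFun (a • const K x) = ‖x‖ • normFun a := by
        ext t; simp [normFun, const, norm_smul, mul_comm]
      change ‖toCFX Φ u (a • const K x)‖ ≤ _
      rw [norm_toCFX, norm_toCFX, this, map_smul, norm_smul, norm_norm])

/-- The map `φ ↦ φ x⃗` from `F` to `F_π(X)`: the extension by continuity of `a u ↦ a x⃗`
(`a ∈ C(K)`) along the isometry `a ↦ a u`, whose range is dense in `F` since `u` is a
quasi-interior point. For `x ≠ 0` it is `‖x‖` times the isometric isomorphism of `F` onto the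
cyclic subspace generated by `x⃗` that sends `a u` to `‖x‖⁻¹ a x⃗`. -/
def mulVec (x : X) : F →L[ℝ] Space Φ u X := (mulConst Φ u x).extend (embF Φ u)

end Space

/-- An operator `T` on a `C(K)`-module is a multiplication operator if, for some `a ∈ C(K)`,
`T f = a f` for all `f`. -/
def IsMultiplicationOperator (K : Type*) [TopologicalSpace K] {M : Type*}
    [SMul C(K, ℝ) M] (T : M → M) : Prop :=
  ∃ a : C(K, ℝ), ∀ f : M, T f = a • f

end FPi

end

/-!
For a multiplication operator `T`, the identity holds because the maps `⟨·, x*⟩` and `· x⃗` are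
`C(K)`-linear (`FPi.pairing_smul`, `FPi.mulVec_act`). Conversely, choose `y ∈ X` and `x*` with
`⟨y, x*⟩ = 1` and put `w = ⟨T y⃗, x*⟩ ∈ F`. The identity for `f = y⃗` reads `T (a x⃗) = a (w x⃗)` for
all `a ∈ C(K)` and `x ∈ X`, so `T` is multiplication by `c` on the dense span of the `a x⃗` as soon
as `w = c u` with `c ∈ C(K)`. Now `a u ↦ a w` is the bounded operator `⟨T (· y⃗), x*⟩` on `F`, whence
`‖a w‖ ≤ C ‖a u‖` for all `a`; testing with functions `a` that live where `|w|` is larger than `C u`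
gives `|w| ≤ C u` (`FPi.abs_le_of_norm_act_le`).

What remains, and what also makes the extension `φ ↦ φ x⃗` from `{a u}` to `F` meaningful, is that
every element of the principal ideal of `u` has the form `c u` with `c ∈ C(K) = Z(F)`
(`FPi.exists_emb_eq`). This says that for `|y| ≤ d u` some central operator sends `u` to `y`
(`FPi.exists_isCentral_apply_unit`): it is "multiplication by `y`" on the principal ideal. To define
it, the real lattice homomorphisms `φ` on the ideal with `φ u = 1` are shown to determine the order
(`FPi.le_of_forall_isUnitalLatticeHom`), so that the ideal is a uniformly closed sublattice, with
unit, of the bounded functions on the set of these `φ`. Such a sublattice is closed under squares by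
the lattice form of the Stone–Weierstrass theorem, hence under products (`FPi.exists_mul`). No
topology on the set of homomorphisms is needed. Multiplication by `y` satisfies `|S x| ≤ d |x|`, so
it extends to `F` by continuity.
-/

set_option linter.unusedSectionVars false

noncomputable section

namespace FPi

open UniformSpace

/-! ### Vector lattices with a strong unit: real lattice homomorphisms separate points -/

section Yosida

variable {E : Type*} [AddCommGroup E] [Lattice E] [IsOrderedAddMonoid E]

theorem inf_add_le_inf_add_inf {y a b : E} (hy : 0 ≤ y) (ha : 0 ≤ a) (hb : 0 ≤ b) :
    y ⊓ (a + b) ≤ y ⊓ a + y ⊓ b := by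
  rw [add_inf, inf_add, inf_add]
  refine le_inf (le_inf ?_ ?_) (le_inf ?_ inf_le_right)
  · exact inf_le_left.trans (le_add_of_nonneg_right hy)
  · exact inf_le_left.trans (le_add_of_nonneg_left ha)
  · exact inf_le_left.trans (le_add_of_nonneg_right hb)

theorem inf_nsmul_le_nsmul_inf {y a : E} (hy : 0 ≤ y) (ha : 0 ≤ a) (n : ℕ) :
    y ⊓ n • a ≤ n • (y ⊓ a) := by
  induction n with
  | zero => simp
  | succ n ih =>
    rw [succ_nsmul, succ_nsmul]
    exact (inf_add_le_inf_add_inf hy (nsmul_nonneg ha n) ha).trans (by gcongr)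

/-- If `u ≤ m + k b` and `a` is disjoint from `b`, then `m` dominates `a ⊓ u`, so a multiple of
`m` dominates each such `a` below a multiple of `u`. -/
theorem le_nsmul_of_disjoint {u a b m : E} (hu : 0 ≤ u) (ha : 0 ≤ a) (hb : 0 ≤ b) (hm : 0 ≤ m)
    (hab : a ⊓ b = 0) {k n : ℕ} (h : u ≤ m + k • b) (han : a ≤ n • u) : a ≤ n • m := by
  have h1 : a ⊓ u ≤ m := calc
    a ⊓ u ≤ a ⊓ (m + k • b) := inf_le_inf_left _ h
    _ ≤ a ⊓ m + a ⊓ k • b := inf_add_le_inf_add_inf ha hm (nsmul_nonneg hb k)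
    _ ≤ m + k • (a ⊓ b) := add_le_add inf_le_right (inf_nsmul_le_nsmul_inf ha hb k)
    _ = m := by simp [hab]
  calc a = a ⊓ n • u := (inf_eq_left.2 han).symm
    _ ≤ n • (a ⊓ u) := inf_nsmul_le_nsmul_inf ha hu n
    _ ≤ n • m := by gcongr

/-- The sets `{x | x⁺ ∈ J}`, for `J` an ideal not containing `u`. For `J` the kernel of a real
lattice homomorphism `φ`, this is `{x | φ x ≤ 0}`. -/
structure IsProperCone (u : E) (M : Set E) : Prop where
  zero_mem : 0 ∈ M
  add_mem : ∀ {x y}, x ∈ M → y ∈ M → x + y ∈ M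
  lower : ∀ {x y}, x ≤ y → y ∈ M → x ∈ M
  posPart_mem : ∀ {x}, x ∈ M → x⁺ ∈ M
  unit_notMem : u ∉ M

namespace IsProperCone

variable {u : E} {M : Set E}

theorem nsmul_mem (h : IsProperCone u M) {x : E} (hx : x ∈ M) (n : ℕ) : n • x ∈ M := by
  induction n with
  | zero => simpa using h.zero_mem
  | succ n ih => rw [succ_nsmul]; exact h.add_mem ih hx

/-- Zorn's lemma: a union of a chain of proper cones still omits `u`. -/
theorem exists_maximal (h : IsProperCone u M) :
    ∃ N, M ⊆ N ∧ Maximal (IsProperCone u) N := by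
  refine zorn_subset_nonempty {N | IsProperCone u N} (fun c hsub hchain ⟨N₀, hN₀⟩ => ?_) M h
  have hc : ∀ {A}, A ∈ c → IsProperCone u A := fun hA => hsub hA
  refine ⟨⋃₀ c, ⟨⟨N₀, hN₀, (hc hN₀).zero_mem⟩, ?_, ?_, ?_, ?_⟩,
    fun s hs => Set.subset_sUnion_of_mem hs⟩
  · rintro x y ⟨A, hA, hx⟩ ⟨B, hB, hy⟩
    rcases hchain.total hA hB with hAB | hBA
    · exact ⟨B, hB, (hc hB).add_mem (hAB hx) hy⟩
    · exact ⟨A, hA, (hc hA).add_mem hx (hBA hy)⟩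
  · rintro x y hxy ⟨A, hA, hy⟩
    exact ⟨A, hA, (hc hA).lower hxy hy⟩
  · rintro x ⟨A, hA, hx⟩
    exact ⟨A, hA, (hc hA).posPart_mem hx⟩
  · rintro ⟨A, hA, hx⟩
    exact (hc hA).unit_notMem hx

/-- Maximal cones are prime: they contain `x` or `-x`, since `x⁺` and `x⁻` are disjoint. -/
theorem mem_or_neg_mem (hM : Maximal (IsProperCone u) M) (hu : 0 ≤ u)
    (hunit : ∀ x : E, ∃ n : ℕ, x ≤ n • u) (x : E) : x ∈ M ∨ -x ∈ M := by
  by_contra! hx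
  have h := hM.prop
  -- The cone generated by `M` and `x⁺` must contain `u`.
  have key : ∃ m ∈ M, ∃ n : ℕ, u ≤ m + n • x⁺ := by
    by_contra hne
    have hN : IsProperCone u {y | ∃ m ∈ M, ∃ n : ℕ, y ≤ m + n • x⁺} := by
      refine ⟨⟨0, h.zero_mem, 0, by simp⟩, ?_, ?_, ?_, hne⟩
      · rintro y z ⟨m, hm, k, hy⟩ ⟨m', hm', k', hz⟩
        refine ⟨m + m', h.add_mem hm hm', k + k', (add_le_add hy hz).trans_eq ?_⟩
        rw [add_nsmul]; abel
      · rintro y z hyz ⟨m, hm, k, hz⟩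
        exact ⟨m, hm, k, hyz.trans hz⟩
      · rintro y ⟨m, hm, k, hy⟩
        have hk : 0 ≤ k • x⁺ := nsmul_nonneg (posPart_nonneg x) k
        refine ⟨m⁺, h.posPart_mem hm, k, sup_le (hy.trans ?_) (add_nonneg (posPart_nonneg m) hk)⟩
        gcongr
        exact le_posPart m
    refine hx.1 (hM.le_of_ge hN (fun m hm => ⟨m, hm, 0, by simp⟩) ⟨0, h.zero_mem, 1, ?_⟩)
    simpa using le_posPart x
  obtain ⟨m, hm, k, hk⟩ := key
  obtain ⟨n, hn⟩ := hunit x⁻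
  have hd : x⁻ ⊓ x⁺ = 0 := by rw [inf_comm, posPart_inf_negPart_eq_zero]
  have hle : x⁻ ≤ n • m⁺ :=
    le_nsmul_of_disjoint hu (negPart_nonneg x) (posPart_nonneg x) (posPart_nonneg m) hd
      (hk.trans (by gcongr; exact le_posPart m)) hn
  exact hx.2 (h.lower ((neg_le_negPart x).trans hle) (h.nsmul_mem (h.posPart_mem hm) n))

end IsProperCone

variable [Module ℝ E] [IsOrderedModule ℝ E]

/-- Real-valued lattice homomorphisms that send `u` to `1`: the points of the space on which
the vector lattice with strong unit `u` is represented. -/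
structure IsUnitalLatticeHom (u : E) (φ : E →ₗ[ℝ] ℝ) : Prop where
  map_unit : φ u = 1
  map_sup : ∀ x y, φ (x ⊔ y) = φ x ⊔ φ y

namespace IsUnitalLatticeHom

variable {u : E} {φ : E →ₗ[ℝ] ℝ}

theorem map_inf (h : IsUnitalLatticeHom u φ) (x y : E) : φ (x ⊓ y) = φ x ⊓ φ y := by
  have := h.map_sup (-x) (-y)
  rw [← neg_inf, map_neg, map_neg, map_neg, ← neg_inf] at this
  exact neg_injective this

theorem map_abs (h : IsUnitalLatticeHom u φ) (x : E) : φ |x| = |φ x| := by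
  rw [abs, h.map_sup, map_neg]; rfl

theorem mono (h : IsUnitalLatticeHom u φ) {x y : E} (hxy : x ≤ y) : φ x ≤ φ y := by
  have := h.map_sup x y
  rw [sup_eq_right.2 hxy] at this
  rw [this]; exact le_sup_left

theorem abs_le_of_abs_le (h : IsUnitalLatticeHom u φ) {x : E} {c : ℝ} (hx : |x| ≤ c • u) :
    |φ x| ≤ c := by
  simpa [h.map_abs, h.map_unit] using h.mono hx

end IsUnitalLatticeHom

theorem exists_le_nsmul {u : E} (hu : 0 ≤ u) (hunit : ∀ x : E, ∃ c : ℝ, |x| ≤ c • u) (x : E) :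
    ∃ n : ℕ, x ≤ n • u := by
  obtain ⟨c, hc⟩ := hunit x
  obtain ⟨n, hn⟩ := exists_nat_ge c
  refine ⟨n, (le_abs_self x).trans (hc.trans ?_)⟩
  rw [← Nat.cast_smul_eq_nsmul ℝ]
  exact smul_le_smul_of_nonneg_right hn hu

namespace IsProperCone

variable {u : E} {M : Set E}

theorem smul_mem (h : IsProperCone u M) {x : E} (hx : x ∈ M) {r : ℝ} (hr : 0 ≤ r) :
    r • x ∈ M := by
  obtain ⟨n, hn⟩ := exists_nat_ge r
  refine h.lower ?_ (h.nsmul_mem (h.posPart_mem hx) n)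
  rw [← Nat.cast_smul_eq_nsmul ℝ]
  exact (smul_le_smul_of_nonneg_left (le_posPart x) hr).trans
    (smul_le_smul_of_nonneg_right hn (posPart_nonneg x))

theorem smul_unit_notMem (h : IsProperCone u M) {r : ℝ} (hr : 0 < r) : r • u ∉ M := fun hm =>
  h.unit_notMem (by simpa [smul_smul, hr.ne'] using h.smul_mem hm (inv_nonneg.2 hr.le))

/-- The value at `y` of the functional attached to a maximal cone `M`. It is meaningful only if
the set is non-empty and bounded above, which `value_spec` derives from `u` being a strong unit. -/
def value (_h : IsProperCone u M) (y : E) : ℝ := sSup {t : ℝ | t • u - y ∈ M}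

/-- The cuts `{t | t u - y ∈ M}` and `{t | y - t u ∈ M}` determine the value at `y`. -/
theorem value_eq (h : IsProperCone u M) {y : E} {s : ℝ}
    (h1 : ∀ e > 0, (s - e) • u - y ∈ M) (h2 : ∀ e > 0, y - (s + e) • u ∈ M) :
    h.value y = s := by
  have ub : ∀ t ∈ {t : ℝ | t • u - y ∈ M}, t ≤ s := by
    intro t ht
    by_contra! hlt
    refine h.smul_unit_notMem (r := (t - s) / 2) (by linarith) ?_
    have := h.add_mem ht (h2 ((t - s) / 2) (by linarith))
    convert this using 1
    module
  apply le_antisymm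
  · exact csSup_le ⟨s - 1, h1 1 one_pos⟩ ub
  · exact le_of_forall_sub_le fun e he => le_csSup ⟨s, ub⟩ (h1 e he)

theorem value_spec (hM : Maximal (IsProperCone u) M) (hu : 0 ≤ u)
    (hunit : ∀ x : E, ∃ c : ℝ, |x| ≤ c • u) (y : E) {e : ℝ} (he : 0 < e) :
    (hM.prop.value y - e) • u - y ∈ M ∧ y - (hM.prop.value y + e) • u ∈ M := by
  have h := hM.prop
  obtain ⟨c, hc⟩ := hunit y
  have hne : ({t : ℝ | t • u - y ∈ M}).Nonempty := by
    refine ⟨-c, h.lower ?_ h.zero_mem⟩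
    rw [neg_smul, sub_nonpos]
    exact neg_le.1 ((neg_le_abs y).trans hc)
  have hbd : BddAbove {t : ℝ | t • u - y ∈ M} := by
    refine ⟨c, fun t ht => ?_⟩
    by_contra! hlt
    refine h.smul_unit_notMem (sub_pos.2 hlt) (h.lower ?_ ht)
    rw [sub_smul]
    exact sub_le_sub_left ((le_abs_self y).trans hc) _
  constructor
  · obtain ⟨t, ht, hlt⟩ := exists_lt_of_lt_csSup hne (sub_lt_self (h.value y) he)
    refine h.lower (sub_le_sub_right (smul_le_smul_of_nonneg_right hlt.le hu) y) ht
  · rcases mem_or_neg_mem hM hu (exists_le_nsmul hu hunit) (y - (h.value y + e) • u) with h' | h'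
    · exact h'
    · rw [neg_sub] at h'
      have := le_csSup hbd h'
      exact absurd this (not_le.2 (lt_add_of_pos_right _ he))

/-- The real lattice homomorphism attached to a maximal cone `M`. -/
theorem exists_isUnitalLatticeHom (hM : Maximal (IsProperCone u) M) (hu : 0 ≤ u)
    (hunit : ∀ x : E, ∃ c : ℝ, |x| ≤ c • u) :
    ∃ φ : E →ₗ[ℝ] ℝ, IsUnitalLatticeHom u φ ∧ ∀ x ∈ M, φ x ≤ 0 := by
  have h := hM.prop
  have spec := fun y {e} (he : (0 : ℝ) < e) => value_spec hM hu hunit y he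
  have add : ∀ x y, h.value (x + y) = h.value x + h.value y := by
    intro x y
    refine h.value_eq (fun e he => ?_) (fun e he => ?_)
    · convert h.add_mem (spec x (half_pos he)).1 (spec y (half_pos he)).1 using 1
      module
    · convert h.add_mem (spec x (half_pos he)).2 (spec y (half_pos he)).2 using 1
      module
  have pos : ∀ r : ℝ, 0 < r → ∀ x, h.value (r • x) = r * h.value x := by
    intro r hr x
    refine h.value_eq (fun e he => ?_) (fun e he => ?_)
    · convert h.smul_mem (spec x (div_pos he hr)).1 hr.le using 1
      rw [smul_sub, smul_smul, mul_sub, mul_div_cancel₀ _ hr.ne']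
    · convert h.smul_mem (spec x (div_pos he hr)).2 hr.le using 1
      rw [smul_sub, smul_smul, mul_add, mul_div_cancel₀ _ hr.ne']
  let ψ : E →+ ℝ := AddMonoidHom.mk' h.value add
  have smul : ∀ (r : ℝ) x, ψ (r • x) = r * ψ x := by
    intro r x
    rcases lt_trichotomy r 0 with hr | rfl | hr
    · have := pos (-r) (neg_pos.2 hr) x
      change ψ ((-r) • x) = -r * ψ x at this
      rw [neg_smul, map_neg] at this
      linarith
    · simp
    · exact pos r hr x
  let φ : E →ₗ[ℝ] ℝ := { ψ with map_smul' := smul }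
  have hφ : ∀ x, φ x = h.value x := fun x => rfl
  have nonpos : ∀ x ∈ M, φ x ≤ 0 := by
    intro x hx
    by_contra! hlt
    rw [hφ] at hlt
    refine h.smul_unit_notMem (half_pos hlt) ?_
    convert h.add_mem (spec x (half_pos hlt)).1 hx using 1
    module
  have nonneg : ∀ x, 0 ≤ x → 0 ≤ φ x := fun x hx => by
    have := nonpos (-x) (h.lower (neg_nonpos.2 hx) h.zero_mem)
    rw [map_neg] at this
    linarith
  have hpos : ∀ x, φ x⁺ = φ x ⊔ 0 := by
    intro x
    have e : φ x = φ x⁺ - φ x⁻ := by rw [← map_sub, posPart_sub_negPart]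
    rcases mem_or_neg_mem hM hu (exists_le_nsmul hu hunit) x with hx | hx
    · rw [sup_eq_right.2 (nonpos x hx)]
      exact le_antisymm (nonpos _ (h.posPart_mem hx)) (nonneg _ (posPart_nonneg x))
    · have h0 : φ x⁻ = 0 := by
        have := h.posPart_mem hx
        rw [posPart_neg] at this
        exact le_antisymm (nonpos _ this) (nonneg _ (negPart_nonneg x))
      rw [h0, sub_zero] at e
      rw [e, sup_eq_left.2 (nonneg _ (posPart_nonneg x))]
  refine ⟨φ, ⟨?_, fun x y => ?_⟩, nonpos⟩
  · rw [hφ]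
    refine h.value_eq (fun e he => h.lower ?_ h.zero_mem) (fun e he => h.lower ?_ h.zero_mem)
    · have : (1 - e) • u - u = -(e • u) := by module
      rw [this, neg_nonpos]
      exact smul_nonneg he.le hu
    · have : u - (1 + e) • u = -(e • u) := by module
      rw [this, neg_nonpos]
      exact smul_nonneg he.le hu
  · rw [sup_eq_add_posPart_sub, map_add, hpos, map_sub, ← max_add_add_left]
    simp

end IsProperCone

/-- In an Archimedean vector lattice with strong unit `u`, the order is determined by the real
lattice homomorphisms. -/
theorem le_of_forall_isUnitalLatticeHom {u : E} (hu : 0 ≤ u)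
    (hunit : ∀ x : E, ∃ c : ℝ, |x| ≤ c • u)
    (harch : ∀ x : E, (∀ e : ℝ, 0 < e → x ≤ e • u) → x ≤ 0) {x y : E}
    (h : ∀ φ, IsUnitalLatticeHom u φ → φ x ≤ φ y) : x ≤ y := by
  rw [← sub_nonpos]
  refine harch _ fun e he => ?_
  by_contra hlt
  set f := x - y with hf
  -- The ideal generated by `(e u - f)⁺` is proper, because `(e u - f)⁻ ≠ 0` is disjoint from it.
  have hM : IsProperCone u {z | ∃ n : ℕ, z ≤ n • (e • u - f)⁺} := by
    refine ⟨⟨0, by simp⟩, ?_, ?_, ?_, ?_⟩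
    · rintro z w ⟨n, hn⟩ ⟨m, hm⟩
      exact ⟨n + m, (add_le_add hn hm).trans_eq (add_nsmul _ _ _).symm⟩
    · rintro z w hzw ⟨n, hn⟩
      exact ⟨n, hzw.trans hn⟩
    · rintro z ⟨n, hn⟩
      exact ⟨n, sup_le hn (nsmul_nonneg (posPart_nonneg _) n)⟩
    · rintro ⟨k, hk⟩
      obtain ⟨n, hn⟩ := exists_le_nsmul hu hunit (e • u - f)⁻
      have hd : (e • u - f)⁻ ⊓ (e • u - f)⁺ = 0 := by
        rw [inf_comm, posPart_inf_negPart_eq_zero]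
      have h0 : (e • u - f)⁻ ≤ n • (0 : E) := le_nsmul_of_disjoint hu (negPart_nonneg _)
        (posPart_nonneg _) le_rfl hd (k := k) (by simpa using hk) hn
      have h1 : -(e • u - f) ≤ 0 := (neg_le_negPart _).trans (by simpa using h0)
      exact hlt (by simpa using h1)
  obtain ⟨N, hMN, hN⟩ := hM.exists_maximal
  obtain ⟨φ, hφ, hneg⟩ := IsProperCone.exists_isUnitalLatticeHom hN hu hunit
  have h1 := hneg (e • u - f) (hMN ⟨1, by simpa using le_posPart (e • u - f)⟩)
  have h2 := h φ hφ
  rw [map_sub, map_smul, hφ.map_unit, hf, map_sub, smul_eq_mul, mul_one] at h1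
  linarith

theorem eq_of_forall_isUnitalLatticeHom {u : E} (hu : 0 ≤ u)
    (hunit : ∀ x : E, ∃ c : ℝ, |x| ≤ c • u)
    (harch : ∀ x : E, (∀ e : ℝ, 0 < e → x ≤ e • u) → x ≤ 0) {x y : E}
    (h : ∀ φ, IsUnitalLatticeHom u φ → φ x = φ y) : x = y :=
  le_antisymm (le_of_forall_isUnitalLatticeHom hu hunit harch fun φ hφ => (h φ hφ).le)
    (le_of_forall_isUnitalLatticeHom hu hunit harch fun φ hφ => (h φ hφ).ge)

theorem abs_le_of_forall_isUnitalLatticeHom {u : E} (hu : 0 ≤ u)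
    (hunit : ∀ x : E, ∃ c : ℝ, |x| ≤ c • u)
    (harch : ∀ x : E, (∀ e : ℝ, 0 < e → x ≤ e • u) → x ≤ 0) {x y : E}
    (h : ∀ φ, IsUnitalLatticeHom u φ → |φ x| ≤ φ y) : |x| ≤ y :=
  le_of_forall_isUnitalLatticeHom hu hunit harch fun φ hφ => (hφ.map_abs x).trans_le (h φ hφ)

/-! ### The product of a uniformly complete vector lattice with a strong unit -/

/-- An Archimedean vector lattice (`harch`) with strong unit `u` (`hunit`) in which uniformly Cauchy
sequences converge (`hcompl`; the rate `2 / (n + 1)` loses no generality) has squares, because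
`t ↦ t ^ 2` is a uniform limit of lattice polynomials in `t` and constants. -/
theorem exists_sq {u : E} (hu : 0 ≤ u)
    (hunit : ∀ x : E, ∃ c : ℝ, |x| ≤ c • u)
    (harch : ∀ x : E, (∀ e : ℝ, 0 < e → x ≤ e • u) → x ≤ 0)
    (hcompl : ∀ s : ℕ → E, (∀ n m, n ≤ m → |s n - s m| ≤ (2 / (n + 1) : ℝ) • u) →
      ∃ l, ∀ n, |s n - l| ≤ (2 / (n + 1) : ℝ) • u) (x : E) :
    ∃ z : E, ∀ φ, IsUnitalLatticeHom u φ → φ z = φ x ^ 2 := by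
  obtain ⟨c, hc⟩ := hunit x
  let I := Set.Icc (-c) c
  have hmem : ∀ φ, IsUnitalLatticeHom u φ → φ x ∈ I := fun φ hφ =>
    abs_le.1 (hφ.abs_le_of_abs_le hc)
  let A : Set C(I, ℝ) := {g | ∃ z : E, ∀ φ (hφ : IsUnitalLatticeHom u φ),
    φ z = g ⟨φ x, hmem φ hφ⟩}
  have hA : closure A = ⊤ := by
    refine ContinuousMap.sublattice_closure_eq_top A ⟨0, 0, by simp⟩ ?_ ?_ ?_
    · rintro f ⟨z, hz⟩ g ⟨w, hw⟩
      exact ⟨z ⊓ w, fun φ hφ => by rw [hφ.map_inf, hz φ hφ, hw φ hφ]; rfl⟩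
    · rintro f ⟨z, hz⟩ g ⟨w, hw⟩
      exact ⟨z ⊔ w, fun φ hφ => by rw [hφ.map_sup, hz φ hφ, hw φ hφ]; rfl⟩
    · intro v p q
      -- the affine function through the two prescribed values
      have haff : ∀ r s : ℝ, (⟨fun t : I => r * t + s, by fun_prop⟩ : C(I, ℝ)) ∈ A :=
        fun r s => ⟨r • x + s • u, fun φ hφ => by simp [hφ.map_unit]⟩
      by_cases hpq : p = q
      · subst hpq
        exact ⟨_, haff 0 (v p), by simp, by simp⟩
      · have hne : (q : ℝ) - p ≠ 0 := sub_ne_zero.2 fun h => hpq (Subtype.ext h.symm)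
        refine ⟨_, haff ((v q - v p) / (q - p)) (v p - (v q - v p) / (q - p) * p), ?_, ?_⟩
        · simp
        · simp only [ContinuousMap.coe_mk]
          field_simp
          ring
  let sq : C(I, ℝ) := ⟨fun t => (t : ℝ) ^ 2, by fun_prop⟩
  have happrox : ∀ n : ℕ, ∃ z : E, ∀ φ, IsUnitalLatticeHom u φ →
      |φ z - φ x ^ 2| ≤ 1 / (n + 1) := by
    intro n
    have hsq : sq ∈ closure A := by rw [hA]; trivial
    obtain ⟨g, ⟨z, hz⟩, hg⟩ := Metric.mem_closure_iff.1 hsq (1 / (n + 1)) Nat.one_div_pos_of_nat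
    refine ⟨z, fun φ hφ => ?_⟩
    rw [hz φ hφ]
    have : dist (sq _) (g _) ≤ _ :=
      (ContinuousMap.dist_apply_le_dist (⟨φ x, hmem φ hφ⟩ : I)).trans hg.le
    rwa [dist_comm] at this
  choose s hs using happrox
  obtain ⟨l, hl⟩ := hcompl s fun n m hnm => by
    refine abs_le_of_forall_isUnitalLatticeHom hu hunit harch fun φ hφ => ?_
    have h1 := hs n φ hφ
    have h2 := (hs m φ hφ).trans (Nat.one_div_le_one_div hnm)
    rw [map_sub, map_smul, hφ.map_unit, smul_eq_mul, mul_one]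
    calc |φ (s n) - φ (s m)| = |(φ (s n) - φ x ^ 2) - (φ (s m) - φ x ^ 2)| := by ring_nf
      _ ≤ 1 / (n + 1) + 1 / (n + 1) := (abs_sub _ _).trans (add_le_add h1 h2)
      _ = 2 / (n + 1) := by ring
  refine ⟨l, fun φ hφ => ?_⟩
  have hlim : Filter.Tendsto (fun n : ℕ => 3 * (1 / ((n : ℝ) + 1))) Filter.atTop (nhds (3 * 0)) :=
    tendsto_one_div_add_atTop_nhds_zero_nat.const_mul 3
  rw [mul_zero] at hlim
  have : |φ l - φ x ^ 2| ≤ 0 := ge_of_tendsto' hlim fun n => by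
    have h1 := hs n φ hφ
    have h2 := hφ.abs_le_of_abs_le (hl n)
    rw [map_sub] at h2
    calc |φ l - φ x ^ 2| = |(φ (s n) - φ x ^ 2) - (φ (s n) - φ l)| := by ring_nf
      _ ≤ 1 / (n + 1) + 2 / (n + 1) := (abs_sub _ _).trans (add_le_add h1 h2)
      _ = _ := by ring
  exact sub_eq_zero.1 (abs_nonpos_iff.1 this)

/-- Products are obtained from squares by polarization. -/
theorem exists_mul {u : E} (hu : 0 ≤ u)
    (hunit : ∀ x : E, ∃ c : ℝ, |x| ≤ c • u)
    (harch : ∀ x : E, (∀ e : ℝ, 0 < e → x ≤ e • u) → x ≤ 0)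
    (hcompl : ∀ s : ℕ → E, (∀ n m, n ≤ m → |s n - s m| ≤ (2 / (n + 1) : ℝ) • u) →
      ∃ l, ∀ n, |s n - l| ≤ (2 / (n + 1) : ℝ) • u) (x y : E) :
    ∃ z : E, ∀ φ, IsUnitalLatticeHom u φ → φ z = φ x * φ y := by
  obtain ⟨z, hz⟩ := exists_sq hu hunit harch hcompl (x + y)
  obtain ⟨w, hw⟩ := exists_sq hu hunit harch hcompl (x - y)
  refine ⟨(4⁻¹ : ℝ) • (z - w), fun φ hφ => ?_⟩
  rw [map_smul, map_sub, hz φ hφ, hw φ hφ, map_add, map_sub, smul_eq_mul]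
  ring

/-- Multiplication by `y`, where `|y| ≤ c u`, is a linear map that enlarges absolute values at
most by the factor `c`, and it sends `u` to `y`. -/
theorem exists_linearMap_abs_le {u : E} (hu : 0 ≤ u)
    (hunit : ∀ x : E, ∃ c : ℝ, |x| ≤ c • u)
    (harch : ∀ x : E, (∀ e : ℝ, 0 < e → x ≤ e • u) → x ≤ 0)
    (hcompl : ∀ s : ℕ → E, (∀ n m, n ≤ m → |s n - s m| ≤ (2 / (n + 1) : ℝ) • u) →
      ∃ l, ∀ n, |s n - l| ≤ (2 / (n + 1) : ℝ) • u) {y : E} {c : ℝ} (hy : |y| ≤ c • u) :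
    ∃ S : E →ₗ[ℝ] E, (∀ x, |S x| ≤ c • |x|) ∧ S u = y := by
  choose S hS using exists_mul hu hunit harch hcompl y
  refine ⟨{ toFun := S, map_add' := fun a b => ?_, map_smul' := fun r a => ?_ }, fun x => ?_, ?_⟩
  · refine eq_of_forall_isUnitalLatticeHom hu hunit harch fun φ hφ => ?_
    simp only [hS _ φ hφ, map_add, mul_add]
  · refine eq_of_forall_isUnitalLatticeHom hu hunit harch fun φ hφ => ?_
    simp only [hS _ φ hφ, map_smul, smul_eq_mul, RingHom.id_apply]
    ring
  · refine abs_le_of_forall_isUnitalLatticeHom hu hunit harch fun φ hφ => ?_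
    change |φ (S x)| ≤ _
    rw [hS _ φ hφ, map_smul, hφ.map_abs, abs_mul, smul_eq_mul]
    exact mul_le_mul_of_nonneg_right (hφ.abs_le_of_abs_le hy) (abs_nonneg _)
  · refine eq_of_forall_isUnitalLatticeHom hu hunit harch fun φ hφ => ?_
    change φ (S u) = φ y
    rw [hS _ φ hφ, hφ.map_unit, mul_one]

end Yosida

/-! ### The principal ideal of a quasi-interior point -/

section PrincipalIdeal

variable {F : Type*} [NormedAddCommGroup F] [NormedSpace ℝ F] [Lattice F]
  [IsOrderedAddMonoid F] [IsOrderedModule ℝ F]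

theorem abs_smul_le_smul_abs (r : ℝ) (x : F) : |r • x| ≤ |r| • |x| := by
  have key : ∀ y : F, |y| = |x| → r • y ≤ |r| • |x| := by
    intro y hy
    rcases le_total 0 r with hr | hr
    · rw [abs_of_nonneg hr, ← hy]
      exact smul_le_smul_of_nonneg_left (le_abs_self y) hr
    · rw [abs_of_nonpos hr, ← hy, ← neg_smul_neg]
      exact smul_le_smul_of_nonneg_left (neg_le_abs y) (neg_nonneg.2 hr)
  refine sup_le (key x rfl) ?_
  rw [← smul_neg]
  exact key (-x) (abs_neg x)

/-- The order ideal `{y | |y| ≤ c u for some c}` generated by `u`. -/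
def principalIdeal (u : QuasiInteriorPoint F) : Submodule ℝ F where
  carrier := {y | ∃ c : ℝ, |y| ≤ c • u.val}
  add_mem' := by
    rintro x y ⟨c, hc⟩ ⟨d, hd⟩
    exact ⟨c + d, (abs_add_le x y).trans ((add_le_add hc hd).trans_eq (add_smul _ _ _).symm)⟩
  zero_mem' := ⟨0, by simp⟩
  smul_mem' := by
    rintro r x ⟨c, hc⟩
    refine ⟨|r| * c, (abs_smul_le_smul_abs r x).trans ?_⟩
    rw [mul_smul]
    exact smul_le_smul_of_nonneg_left hc (abs_nonneg r)

variable (u : QuasiInteriorPoint F)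

theorem mem_principalIdeal_of_abs_le {x y : F} (hy : y ∈ principalIdeal u) (h : |x| ≤ |y|) :
    x ∈ principalIdeal u := by
  obtain ⟨c, hc⟩ := hy
  exact ⟨c, h.trans hc⟩

theorem abs_mem_principalIdeal {y : F} (hy : y ∈ principalIdeal u) : |y| ∈ principalIdeal u :=
  mem_principalIdeal_of_abs_le u hy (abs_abs y).le

theorem unit_mem_principalIdeal : u.val ∈ principalIdeal u :=
  ⟨1, by rw [one_smul, abs_of_nonneg u.nonneg]⟩

theorem sup_mem_principalIdeal {x y : F} (hx : x ∈ principalIdeal u) (hy : y ∈ principalIdeal u) :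
    x ⊔ y ∈ principalIdeal u := by
  have h0 : 0 ≤ |x| + |y| := add_nonneg (abs_nonneg x) (abs_nonneg y)
  refine mem_principalIdeal_of_abs_le u
    (add_mem (abs_mem_principalIdeal u hx) (abs_mem_principalIdeal u hy)) ?_
  rw [abs_of_nonneg h0]
  refine sup_le (sup_le ?_ ?_) ?_
  · exact (le_abs_self x).trans (le_add_of_nonneg_right (abs_nonneg y))
  · exact (le_abs_self y).trans (le_add_of_nonneg_left (abs_nonneg x))
  · rw [neg_sup]
    exact inf_le_left.trans ((neg_le_abs x).trans (le_add_of_nonneg_right (abs_nonneg y)))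

instance : Lattice (principalIdeal u) :=
  Subtype.lattice (P := fun y => y ∈ principalIdeal u)
    (fun _ _ hx hy => sup_mem_principalIdeal u hx hy)
    (fun x y hx hy => by
      have := neg_mem (sup_mem_principalIdeal u (neg_mem hx) (neg_mem hy))
      rwa [neg_sup, neg_neg, neg_neg] at this)

instance : IsOrderedAddMonoid (principalIdeal u) where
  add_le_add_left _ _ h c := add_le_add_left (α := F) h c

instance : IsOrderedModule ℝ (principalIdeal u) where
  smul_le_smul_of_nonneg_left _ hr _ _ h := smul_le_smul_of_nonneg_left (β := F) h hr
  smul_le_smul_of_nonneg_right _ hx _ _ h := smul_le_smul_of_nonneg_right (β := F) h hx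

/-- A domination of `S` by `T` on the principal ideal persists on `F`, by density. -/
theorem abs_le_of_dense [HasSolidNorm F] {S T : F →L[ℝ] F}
    (h : ∀ x ∈ principalIdeal u, |S x| ≤ T |x|) (x : F) : |S x| ≤ T |x| := by
  have hcl : IsClosed {x : F | |S x| ≤ T |x|} := by
    simp only [abs]
    exact isClosed_le (by fun_prop) (by fun_prop)
  exact hcl.closure_subset_iff.2 h (u.dense x)

/-- The only element disjoint from `u` is zero. -/
theorem eq_zero_of_inf_unit_eq_zero [HasSolidNorm F] {z : F} (hz : 0 ≤ z)
    (h : z ⊓ u.val = 0) : z = 0 := by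
  have hcl : IsClosed {y : F | z ⊓ |y| ≤ 0} := by
    simp only [abs]
    exact isClosed_le (by fun_prop) (by fun_prop)
  have hsub : {y : F | ∃ c : ℝ, |y| ≤ c • u.val} ⊆ {y : F | z ⊓ |y| ≤ 0} := by
    rintro y ⟨c, hc⟩
    obtain ⟨n, hn⟩ := exists_nat_ge c
    calc z ⊓ |y| ≤ z ⊓ n • u.val := by
          refine inf_le_inf_left _ (hc.trans ?_)
          rw [← Nat.cast_smul_eq_nsmul ℝ]
          exact smul_le_smul_of_nonneg_right hn u.nonneg
      _ ≤ n • (z ⊓ u.val) := inf_nsmul_le_nsmul_inf hz u.nonneg n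
      _ = 0 := by rw [h, nsmul_zero]
  have := hcl.closure_subset_iff.2 hsub (u.dense z)
  simp only [Set.mem_ofPred_eq, abs_of_nonneg hz, inf_idem] at this
  exact le_antisymm this hz

theorem le_zero_of_forall_le_smul [HasSolidNorm F] {x v : F}
    (h : ∀ e : ℝ, 0 < e → x ≤ e • v) : x ≤ 0 := by
  have hlim : Filter.Tendsto (fun n : ℕ => (1 / ((n : ℝ) + 1)) • v) Filter.atTop
      (nhds ((0 : ℝ) • v)) :=
    tendsto_one_div_add_atTop_nhds_zero_nat.smul_const v
  rw [zero_smul] at hlim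
  exact ge_of_tendsto' hlim fun n => h _ Nat.one_div_pos_of_nat

/-- In a Banach lattice every uniformly Cauchy sequence converges uniformly: it is norm Cauchy,
and the cone is closed. -/
theorem exists_uniform_limit [CompleteSpace F] [HasSolidNorm F] (s : ℕ → F) (v : F)
    (hs : ∀ n m, n ≤ m → |s n - s m| ≤ (2 / (n + 1) : ℝ) • v) :
    ∃ l, ∀ n, |s n - l| ≤ (2 / (n + 1) : ℝ) • v := by
  have hlim : Filter.Tendsto (fun n : ℕ => 2 * (1 / ((n : ℝ) + 1)) * ‖v‖) Filter.atTop
      (nhds (2 * 0 * ‖v‖)) :=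
    (tendsto_one_div_add_atTop_nhds_zero_nat.const_mul 2).mul_const _
  rw [mul_zero, zero_mul] at hlim
  have hc : CauchySeq s := by
    refine cauchySeq_of_le_tendsto_0' _ (fun n m hnm => ?_) hlim
    rw [dist_eq_norm]
    refine (norm_le_norm_of_abs_le_abs ((hs n m hnm).trans (le_abs_self _))).trans ?_
    rw [norm_smul, Real.norm_of_nonneg (by positivity)]
    exact (by ring_nf; rfl)
  obtain ⟨l, hl⟩ := cauchySeq_tendsto_of_complete hc
  refine ⟨l, fun n => ?_⟩
  have hcl : IsClosed {y : F | |s n - y| ≤ (2 / (n + 1) : ℝ) • v} := by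
    simp only [abs]
    exact isClosed_le (by fun_prop) (by fun_prop)
  exact hcl.mem_of_tendsto hl ((Filter.eventually_ge_atTop n).mono fun m hm => hs n m hm)

/-- Every element of the principal ideal is the image of `u` under a central operator:
multiplication by that element extends from the ideal to `F` by continuity. -/
theorem exists_isCentral_apply_unit [CompleteSpace F] [HasSolidNorm F] {y : F}
    (hy : y ∈ principalIdeal u) : ∃ S : F →L[ℝ] F, IsCentral S ∧ S u.val = y := by
  obtain ⟨c, hc⟩ := hy
  have hc' : |y| ≤ (|c| + 1) • u.val := hc.trans
    (smul_le_smul_of_nonneg_right (by linarith [le_abs_self c]) u.nonneg)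
  have hpos : 0 < |c| + 1 := by positivity
  generalize |c| + 1 = d at hc' hpos
  let u' : principalIdeal u := ⟨u.val, unit_mem_principalIdeal u⟩
  obtain ⟨S, hS, hSu⟩ := exists_linearMap_abs_le (E := principalIdeal u) (u := u')
    (y := ⟨y, d, hc'⟩) (c := d) u.nonneg (fun x => x.2)
    (fun x hx => le_zero_of_forall_le_smul (F := F) (x := x) (v := u.val) hx)
    (fun s hs => by
      obtain ⟨l, hl⟩ := exists_uniform_limit (fun n => (s n : F)) u.val hs
      have hmem : (s 0 : F) - l ∈ principalIdeal u := ⟨_, hl 0⟩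
      have hl' : l ∈ principalIdeal u := by
        have := sub_mem (s 0).2 hmem
        rwa [sub_sub_cancel] at this
      exact ⟨⟨l, hl'⟩, hl⟩)
    hc'
  have hdense : DenseRange (principalIdeal u).subtype := by
    rw [DenseRange, Submodule.coe_subtype, Subtype.range_coe]
    exact u.dense
  let f : principalIdeal u →ₗ[ℝ] F := (principalIdeal u).subtype ∘ₗ S
  have hSF : ∀ x : principalIdeal u, |f x| ≤ d • |(x : F)| := hS
  have hbound : ∃ C, ∀ x, ‖f x‖ ≤ C * ‖(principalIdeal u).subtype x‖ := by
    refine ⟨d, fun x => (norm_le_norm_of_abs_le_abs ((hSF x).trans (le_abs_self _))).trans ?_⟩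
    rw [norm_smul, norm_abs_eq_norm, Real.norm_of_nonneg hpos.le]
    rfl
  have hext := LinearMap.extendOfNorm_eq (f := f) hdense hbound
  refine ⟨f.extendOfNorm (principalIdeal u).subtype, ⟨d, hpos, fun x hx => ?_⟩, ?_⟩
  · have := abs_le_of_dense u (S := f.extendOfNorm (principalIdeal u).subtype)
      (T := d • ContinuousLinearMap.id ℝ F) (fun z hz => by
        have := hext ⟨z, hz⟩
        simp only [Submodule.subtype_apply] at this
        rw [this]
        exact hSF ⟨z, hz⟩) x
    simpa [abs_of_nonneg hx] using this
  · exact (hext u').trans (congrArg Subtype.val hSu)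

end PrincipalIdeal

/-! ### The action of `C(K)` on `F` -/

section Action

variable {K : Type*} [TopologicalSpace K] [CompactSpace K]
  {F : Type*} [NormedAddCommGroup F] [NormedSpace ℝ F] [Lattice F]
  [IsOrderedAddMonoid F] [IsOrderedModule ℝ F] (Φ : CenterIso K F) (u : QuasiInteriorPoint F)

theorem CenterIso.act_mul (a b : C(K, ℝ)) (x : F) : Φ.act (a * b) x = Φ.act a (Φ.act b x) := by
  simp [CenterIso.act]

theorem CenterIso.act_add (a b : C(K, ℝ)) (x : F) : Φ.act (a + b) x = Φ.act a x + Φ.act b x := by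
  simp [CenterIso.act]

theorem CenterIso.act_sub (a b : C(K, ℝ)) (x : F) : Φ.act (a - b) x = Φ.act a x - Φ.act b x := by
  simp [CenterIso.act]

theorem CenterIso.act_one (x : F) : Φ.act 1 x = x := by
  simp [CenterIso.act]

theorem CenterIso.act_comm (a b : C(K, ℝ)) (x : F) :
    Φ.act a (Φ.act b x) = Φ.act b (Φ.act a x) := by
  rw [← Φ.act_mul, mul_comm, Φ.act_mul]

theorem CenterIso.norm_act (a : C(K, ℝ)) : ‖Φ.act a‖ = ‖a‖ := Φ.norm_map a

theorem CenterIso.act_nonneg {a : C(K, ℝ)} (ha : 0 ≤ a) {x : F} (hx : 0 ≤ x) : 0 ≤ Φ.act a x :=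
  (Φ.nonneg_iff a).1 ha x hx

theorem CenterIso.act_mono {a : C(K, ℝ)} (ha : 0 ≤ a) {x y : F} (h : x ≤ y) :
    Φ.act a x ≤ Φ.act a y := by
  have := Φ.act_nonneg ha (sub_nonneg.2 h)
  rwa [map_sub, sub_nonneg] at this

theorem act_emb (a b : C(K, ℝ)) : Φ.act a (emb Φ u b) = emb Φ u (a * b) :=
  (Φ.act_mul a b u.val).symm

/-- The elements of the principal ideal of `u` are the `a u` with `a ∈ C(K)`. -/
theorem exists_emb_eq [CompleteSpace F] [HasSolidNorm F] {y : F} (hy : y ∈ principalIdeal u) :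
    ∃ a : C(K, ℝ), emb Φ u a = y := by
  obtain ⟨S, hS, hSu⟩ := exists_isCentral_apply_unit u hy
  refine ⟨Φ.toAlgEquiv.symm ⟨S, hS⟩, ?_⟩
  simp only [emb, CenterIso.act, LinearMap.coe_mk, AddHom.coe_mk, AlgEquiv.apply_symm_apply]
  exact hSu

theorem denseRange_emb [CompleteSpace F] [HasSolidNorm F] : DenseRange (emb Φ u) :=
  u.dense.mono fun _ hy => exists_emb_eq Φ u hy

/-- Continuous maps on `F` are determined by their values on `{a u | a ∈ C(K)}`. -/
theorem eq_of_emb_eq [CompleteSpace F] [HasSolidNorm F] {Y : Type*} [TopologicalSpace Y]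
    [T2Space Y] {f g : F → Y} (hf : Continuous f) (hg : Continuous g)
    (h : ∀ a, f (emb Φ u a) = g (emb Φ u a)) : f = g :=
  (denseRange_emb Φ u).equalizer hf hg (funext h)

/-- If `a u = 0`, then `a` annihilates every `b u`, hence `F`. -/
theorem emb_injective [CompleteSpace F] [HasSolidNorm F] : Function.Injective (emb Φ u) := by
  rw [injective_iff_map_eq_zero]
  intro a ha
  have h0 : (Φ.act a : F → F) = fun _ => 0 :=
    eq_of_emb_eq Φ u (Φ.act a).continuous continuous_const fun b => by
      rw [act_emb, mul_comm, ← act_emb, ha, map_zero]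
  have : Φ.act a = 0 := ContinuousLinearMap.ext fun x => congrFun h0 x
  rw [← norm_eq_zero, ← Φ.norm_act, this, norm_zero]

/-- `|a u| = |a| u`. The factor `e = a / (|a| + ε)` of modulus at most one satisfies
`|a| - ε ≤ e a`, so `|a| u ≤ ε u + e (a u)`. -/
theorem abs_emb [HasSolidNorm F] (a : C(K, ℝ)) : |emb Φ u a| = emb Φ u |a| := by
  apply le_antisymm
  · refine sup_le (emb_mono Φ u (le_abs_self a)) ?_
    rw [← map_neg]
    exact emb_mono Φ u (neg_le_abs a)
  · rw [← sub_nonpos]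
    refine le_zero_of_forall_le_smul (v := u.val) fun ε hε => ?_
    have hpos : ∀ t, 0 < |a t| + ε := fun t => by positivity
    let e : C(K, ℝ) := ⟨fun t => a t / (|a t| + ε), by
      exact a.continuous.div₀ (by fun_prop) fun t => (hpos t).ne'⟩
    -- `(1 + e) (|x| - x) + (1 - e) (|x| + x) = 2 (|x| - e x)`, and the left side is non-negative.
    have he : ∀ x : F, Φ.act e x ≤ |x| := by
      intro x
      have he1 : ∀ t, |e t| ≤ 1 := fun t => by
        rw [ContinuousMap.coe_mk, abs_div, abs_of_pos (hpos t), div_le_one (hpos t)]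
        linarith
      have h1 : 0 ≤ Φ.act (1 + e) (|x| - x) := Φ.act_nonneg
        (fun t => by have := (abs_le.1 (he1 t)).1; simp; linarith) (sub_nonneg.2 (le_abs_self x))
      have h2 : 0 ≤ Φ.act (1 - e) (|x| + x) := Φ.act_nonneg
        (fun t => by have := (abs_le.1 (he1 t)).2; simp; linarith)
        (neg_le_iff_add_nonneg.1 (neg_le_abs x))
      have h3 := add_nonneg h1 h2
      have h4 : Φ.act (1 + e) (|x| - x) + Φ.act (1 - e) (|x| + x) =
          (2 : ℝ) • (|x| - Φ.act e x) := by
        rw [Φ.act_add, Φ.act_sub, Φ.act_one, Φ.act_one, map_sub, map_add]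
        module
      rw [h4] at h3
      have h5 := smul_nonneg (inv_nonneg.2 zero_le_two : (0 : ℝ) ≤ 2⁻¹) h3
      rw [smul_smul, inv_mul_cancel₀ two_ne_zero, one_smul] at h5
      exact sub_nonneg.1 h5
    have hle : |a| ≤ ε • 1 + e * a := fun t => by
      change |a t| ≤ ε • (1 : ℝ) + a t / (|a t| + ε) * a t
      rw [smul_eq_mul, mul_one, div_mul_eq_mul_div, ← sq, ← sq_abs, ← sub_le_iff_le_add',
        le_div_iff₀ (hpos t)]
      nlinarith [sq_nonneg ε]
    have h6 := emb_mono Φ u hle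
    rw [map_add, map_smul, ← act_emb] at h6
    rw [sub_le_iff_le_add]
    refine h6.trans (add_le_add (le_of_eq ?_) (he _))
    exact congrArg (ε • ·) (Φ.act_one u.val)

theorem norm_emb_abs [HasSolidNorm F] (a : C(K, ℝ)) : ‖emb Φ u |a|‖ = ‖emb Φ u a‖ := by
  rw [← abs_emb, norm_abs_eq_norm]

/-- Non-negative elements of `C(K)` act as lattice homomorphisms. -/
theorem CenterIso.abs_act [CompleteSpace F] [HasSolidNorm F] (u : QuasiInteriorPoint F)
    {a : C(K, ℝ)} (ha : 0 ≤ a) (x : F) :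
    |Φ.act a x| = Φ.act a |x| := by
  have habs : Continuous fun y : F => |y| := by
    simp only [abs]
    fun_prop
  refine congrFun (eq_of_emb_eq Φ u (f := fun x => |Φ.act a x|) (g := fun x => Φ.act a |x|)
    (habs.comp (Φ.act a).continuous) ((Φ.act a).continuous.comp habs) fun b => ?_) x
  rw [act_emb, abs_emb, abs_emb, act_emb]
  congr 1
  ext t
  change |a t * b t| = a t * |b t|
  rw [abs_mul, abs_of_nonneg (show 0 ≤ a t from ha t)]

/-- If `‖a x‖ ≤ C ‖a u‖` for all `a ∈ C(K)`, then `|x| ≤ C u`. Testing with functions `a` that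
live where the truncation `b u = |x| ⊓ (C + 1) u` has `b > r`, for some `r > C`, gives `a = 0`, so
`b ≤ C`. -/
theorem abs_le_of_norm_act_le [CompleteSpace F] [HasSolidNorm F] {x : F} {C : ℝ} (hC : 0 ≤ C)
    (h : ∀ a : C(K, ℝ), ‖Φ.act a x‖ ≤ C * ‖emb Φ u a‖) : |x| ≤ C • u.val := by
  have hC1 : 0 ≤ C + 1 := by linarith
  have hw0 : 0 ≤ |x| ⊓ (C + 1) • u.val := le_inf (abs_nonneg x) (smul_nonneg hC1 u.nonneg)
  obtain ⟨b, hb⟩ := exists_emb_eq Φ u (y := |x| ⊓ (C + 1) • u.val)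
    ⟨C + 1, by rw [abs_of_nonneg hw0]; exact inf_le_right⟩
  have hbC : ∀ t, b t ≤ C := by
    intro t
    by_contra! ht
    obtain ⟨r, hr, hrt⟩ := exists_between ht
    -- `a` vanishes unless `b > r`, so `r a ≤ a b`.
    let a : C(K, ℝ) := ⟨fun s => max (b s - r) 0, by fun_prop⟩
    have ha : 0 ≤ a := fun s => le_max_right _ _
    have hle : r • a ≤ a * b := fun s => by
      change r * max (b s - r) 0 ≤ max (b s - r) 0 * b s
      rcases le_total (b s - r) 0 with hs | hs
      · simp [max_eq_right hs]
      · rw [max_eq_left hs]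
        nlinarith
    have h1 : r * ‖emb Φ u a‖ ≤ C * ‖emb Φ u a‖ := calc
      r * ‖emb Φ u a‖ = ‖emb Φ u (r • a)‖ := by
        rw [map_smul, norm_smul, Real.norm_of_nonneg (hC.trans hr.le)]
      _ ≤ ‖emb Φ u (a * b)‖ := norm_emb_mono Φ u (smul_nonneg (hC.trans hr.le) ha) hle
      _ ≤ ‖Φ.act a x‖ := by
        rw [← act_emb, hb]
        refine norm_le_norm_of_abs_le_abs ?_
        rw [Φ.abs_act u ha x, abs_of_nonneg (Φ.act_nonneg ha hw0)]
        exact Φ.act_mono ha inf_le_left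
      _ ≤ C * ‖emb Φ u a‖ := h a
    have h2 : ‖emb Φ u a‖ = 0 := by
      by_contra hne
      have : 0 < ‖emb Φ u a‖ := lt_of_le_of_ne (norm_nonneg _) (Ne.symm hne)
      exact absurd (le_of_mul_le_mul_right h1 this) (not_le.2 hr)
    have h3 : a = 0 := emb_injective Φ u (by rw [norm_eq_zero.1 h2, map_zero])
    have h4 : max (b t - r) 0 = 0 := DFunLike.congr_fun h3 t
    have := le_max_left (b t - r) 0
    linarith
  have hle : |x| ⊓ (C + 1) • u.val ≤ C • u.val := by
    rw [← hb]
    refine (emb_mono Φ u (b := C • 1) fun t => by simpa using hbC t).trans_eq ?_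
    rw [map_smul]
    exact congrArg (C • ·) (Φ.act_one u.val)
  have hdis : (|x| - C • u.val)⁺ ⊓ u.val = 0 := by
    let := AddCommGroup.toDistribLattice F
    rw [posPart_def, inf_sup_right, inf_eq_left.2 u.nonneg]
    refine sup_eq_right.2 ?_
    have h5 := sub_le_sub_right hle (C • u.val)
    rw [inf_sub, add_smul, one_smul, add_sub_cancel_left, sub_self] at h5
    exact h5
  have := eq_zero_of_inf_unit_eq_zero u (posPart_nonneg _) hdis
  rw [posPart_eq_zero] at this
  exact sub_nonpos.1 this

end Action

/-! ### The space `F_π(X)` -/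

section Space

variable {K : Type*} [TopologicalSpace K] [CompactSpace K]
  {F : Type*} [NormedAddCommGroup F] [NormedSpace ℝ F] [CompleteSpace F] [Lattice F]
  [IsOrderedAddMonoid F] [IsOrderedModule ℝ F] [HasSolidNorm F]
  {X : Type*} [NormedAddCommGroup X] [NormedSpace ℝ X]
  (Φ : CenterIso K F) (u : QuasiInteriorPoint F)

theorem embF_toCFX (a : C(K, ℝ)) : embF Φ u (toCFX Φ u a) = emb Φ u a := rfl

/-- `a ↦ a u` is an isometry, because `‖|a| u‖ = ‖a u‖`. -/
theorem isUniformInducing_embF : IsUniformInducing (embF Φ u) := by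
  refine (AddMonoidHomClass.isometry_of_norm (embF Φ u) fun f => ?_).isUniformInducing
  obtain ⟨a, rfl⟩ := (toCFX Φ u).surjective f
  rw [embF_toCFX, norm_toCFX, ← norm_emb_abs]
  rfl

theorem denseRange_embF : DenseRange (embF Φ u) := denseRange_emb Φ u

/-- The inclusion of `C(K, X)` with the supremum norm into `F_π(X)`. -/
def incl (X : Type*) [NormedAddCommGroup X] [NormedSpace ℝ X] : C(K, X) →L[ℝ] Space Φ u X :=
  Completion.toComplL (𝕜 := ℝ) ∘L
    LinearMap.mkContinuous (toCFX Φ u (X := X)).toLinearMap ‖u.val‖ fun f => by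
      change ‖toCFX Φ u f‖ ≤ _
      have h := norm_emb_mono Φ u (a := normFun f) (b := ‖f‖ • 1) (fun t => norm_nonneg _)
        fun t => by simpa [normFun] using f.norm_coe_le_norm t
      rw [map_smul, norm_smul, norm_norm, mul_comm] at h
      rw [norm_toCFX]
      refine h.trans_eq ?_
      congr 2
      exact Φ.act_one u.val

theorem denseRange_incl : DenseRange (incl Φ u X) := by
  have h : DenseRange (toCFX Φ u (X := X)) := (toCFX Φ u).surjective.denseRange
  exact Completion.denseRange_coe.comp h (Completion.continuous_coe _)

theorem eq_of_incl_eq {Y : Type*} [TopologicalSpace Y] [T2Space Y] {f g : Space Φ u X → Y}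
    (hf : Continuous f) (hg : Continuous g)
    (h : ∀ x, f (incl Φ u X x) = g (incl Φ u X x)) : f = g :=
  (denseRange_incl Φ u).equalizer hf hg (funext h)

theorem smul_incl (a : C(K, ℝ)) (f : C(K, X)) : a • incl Φ u X f = incl Φ u X (a • f) :=
  (Completion.coe_smul a (toCFX Φ u f)).symm

theorem mulVec_emb (x : X) (a : C(K, ℝ)) :
    mulVec Φ u x (emb Φ u a) = incl Φ u X (a • const K x) :=
  ContinuousLinearMap.extend_eq (mulConst Φ u x) (denseRange_embF Φ u)
    (isUniformInducing_embF Φ u) (toCFX Φ u a)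

theorem pairing_incl (xs : X →L[ℝ] ℝ) (f : C(K, X)) :
    pairing Φ u xs (incl Φ u X f) = emb Φ u (pairC xs f) :=
  ContinuousLinearMap.extend_eq (pairCFX Φ u xs) (e := Completion.toComplL)
    Completion.denseRange_coe (Completion.isUniformInducing_coe _) (toCFX Φ u f)

theorem pairing_smul (xs : X →L[ℝ] ℝ) (a : C(K, ℝ)) (f : Space Φ u X) :
    pairing Φ u xs (a • f) = Φ.act a (pairing Φ u xs f) := by
  refine congrFun (eq_of_incl_eq Φ u (f := fun f => pairing Φ u xs (a • f))
    (g := fun f => Φ.act a (pairing Φ u xs f)) ?_ ?_ fun f => ?_) f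
  · exact (pairing Φ u xs).continuous.comp (continuous_const_smul a)
  · fun_prop
  · rw [smul_incl, pairing_incl, pairing_incl, act_emb]
    congr 1
    ext t
    exact map_smul xs (a t) (f t)

theorem mulVec_act (x : X) (a : C(K, ℝ)) (y : F) :
    mulVec Φ u x (Φ.act a y) = a • mulVec Φ u x y := by
  refine congrFun (eq_of_emb_eq Φ u (f := fun y => mulVec Φ u x (Φ.act a y))
    (g := fun y => a • mulVec Φ u x y) ?_ ?_ fun b => ?_) y
  · fun_prop
  · exact (mulVec Φ u x).continuous.const_smul a
  · change mulVec Φ u x (Φ.act a (emb Φ u b)) = a • mulVec Φ u x (emb Φ u b)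
    rw [act_emb, mulVec_emb, mulVec_emb, smul_incl, mul_smul]

theorem pairing_mulVec (xs : X →L[ℝ] ℝ) (x : X) (y : F) :
    pairing Φ u xs (mulVec Φ u x y) = xs x • y := by
  refine congrFun (eq_of_emb_eq Φ u (f := fun y => pairing Φ u xs (mulVec Φ u x y))
    (g := fun y => xs x • y) ?_ ?_ fun b => ?_) y
  · fun_prop
  · fun_prop
  · rw [mulVec_emb, pairing_incl, ← map_smul]
    congr 1
    ext t
    change xs (b t • x) = xs x * b t
    rw [map_smul, smul_eq_mul, mul_comm]

/-- Finite sums `∑ aᵢ xᵢ` with `aᵢ ∈ C(K)` and `xᵢ ∈ X` are dense in `C(K, X)`, by a partition of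
unity. -/
theorem dense_span_smul_const [T2Space K] :
    Dense (Submodule.span ℝ {f : C(K, X) | ∃ (a : C(K, ℝ)) (x : X), f = a • const K x} :
      Set C(K, X)) := by
  intro f
  rw [Metric.mem_closure_iff]
  intro ε hε
  let U : K → Set K := fun p => f ⁻¹' Metric.ball (f p) (ε / 2)
  have hU : ∀ p, IsOpen (U p) := fun p => Metric.isOpen_ball.preimage f.continuous
  obtain ⟨ρ, hρ⟩ := PartitionOfUnity.exists_isSubordinate isClosed_univ U hU
    fun p _ => Set.mem_iUnion.2 ⟨p, Metric.mem_ball_self (half_pos hε)⟩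
  -- By compactness only finitely many members of the partition are non-zero.
  have hfin : {p | (Function.support (ρ p)).Nonempty}.Finite :=
    ρ.locallyFinite.finite_nonempty_of_compact
  let s := hfin.toFinset
  have hsum : ∀ t, ∑ p ∈ s, ρ p t = 1 := fun t => by
    rw [← ρ.sum_eq_one (Set.mem_univ t)]
    refine (finsum_eq_sum_of_support_subset _ fun p hp => ?_).symm
    rw [Set.Finite.coe_toFinset]
    exact ⟨t, hp⟩
  refine ⟨∑ p ∈ s, ρ p • const K (f p),
    sum_mem fun p _ => Submodule.subset_span ⟨ρ p, f p, rfl⟩, ?_⟩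
  refine lt_of_le_of_lt ((ContinuousMap.dist_le (half_pos hε).le).2 fun t => ?_) (half_lt_self hε)
  have hconv : ∑ p ∈ s, ρ p t • f p ∈ Metric.closedBall (f t) (ε / 2) := by
    have e : ∑ p ∈ s, ρ p t • f p - f t = ∑ p ∈ s, ρ p t • (f p - f t) := by
      simp only [smul_sub, Finset.sum_sub_distrib, ← Finset.sum_smul, hsum t, one_smul]
    rw [mem_closedBall_iff_norm, e]
    calc ‖∑ p ∈ s, ρ p t • (f p - f t)‖ ≤ ∑ p ∈ s, ρ p t * (ε / 2) := by
          refine norm_sum_le_of_le _ fun p _ => ?_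
          rw [norm_smul, Real.norm_of_nonneg (ρ.nonneg p t)]
          by_cases ht : ρ p t = 0
          · simp [ht]
          · refine mul_le_mul_of_nonneg_left ?_ (ρ.nonneg p t)
            have : t ∈ U p := hρ p (subset_tsupport _ ht)
            rw [norm_sub_rev]
            exact (mem_ball_iff_norm.1 this).le
      _ = ε / 2 := by rw [← Finset.sum_mul, hsum, one_mul]
  rw [dist_comm]
  simpa [const] using hconv

end Space

/-- An operator that acts as `c` on the functions `a x⃗` is multiplication by `c`. -/
theorem eq_smul_of_forall_smul_const
    {K : Type*} [TopologicalSpace K] [CompactSpace K] [T2Space K]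
    {F : Type*} [NormedAddCommGroup F] [NormedSpace ℝ F] [CompleteSpace F] [Lattice F]
    [IsOrderedAddMonoid F] [IsOrderedModule ℝ F] [HasSolidNorm F]
    {X : Type*} [NormedAddCommGroup X] [NormedSpace ℝ X]
    (Φ : CenterIso K F) (u : QuasiInteriorPoint F) (T : Space Φ u X →L[ℝ] Space Φ u X)
    (c : C(K, ℝ)) (h : ∀ (a : C(K, ℝ)) (x : X),
      T (incl Φ u X (a • const K x)) = incl Φ u X (c • a • const K x)) (f : Space Φ u X) :
    T f = c • f := by
  let m : C(K, X) →L[ℝ] C(K, X) := LinearMap.mkContinuous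
    { toFun := fun f => c • f
      map_add' := smul_add c
      map_smul' := fun r f => ContinuousMap.ext fun t => smul_comm (c t) r (f t) } ‖c‖
    fun f => (ContinuousMap.norm_le _ (by positivity)).2 fun t =>
      (norm_smul_le (c t) (f t)).trans
        (mul_le_mul (c.norm_coe_le_norm t) (f.norm_coe_le_norm t) (norm_nonneg _) (norm_nonneg _))
  have key : T ∘L incl Φ u X = incl Φ u X ∘L m := by
    refine ContinuousLinearMap.ext_on dense_span_smul_const ?_
    rintro _ ⟨a, x, rfl⟩
    exact h a x
  refine congrFun (eq_of_incl_eq Φ u (f := T) (g := fun f => c • f) T.continuous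
    (continuous_const_smul c) fun f => ?_) f
  rw [smul_incl]
  exact DFunLike.congr_fun key f

end FPi
end

theorem corollary9
    {K : Type*} [TopologicalSpace K] [CompactSpace K] [T2Space K]
    {F : Type*} [NormedAddCommGroup F] [NormedSpace ℝ F] [CompleteSpace F] [Lattice F]
    [IsOrderedAddMonoid F] [IsOrderedModule ℝ F] [HasSolidNorm F]
    {X : Type*} [NormedAddCommGroup X] [NormedSpace ℝ X] [CompleteSpace X]
    (Φ : FPi.CenterIso K F) (u : FPi.QuasiInteriorPoint F)
    (T : FPi.Space Φ u X →L[ℝ] FPi.Space Φ u X) :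
    FPi.IsMultiplicationOperator K T ↔
      ∀ (a : C(K, ℝ)) (f : FPi.Space Φ u X) (x : X) (xs : X →L[ℝ] ℝ),
        T (a • FPi.mulVec Φ u x (FPi.pairing Φ u xs f)) =
          a • FPi.mulVec Φ u x (FPi.pairing Φ u xs (T f)) := by
  open FPi in
  constructor
  · rintro ⟨b, hb⟩ a f x xs
    rw [hb, hb, pairing_smul, ← mulVec_act, ← mulVec_act, ← mulVec_act, Φ.act_comm]
  · intro h
    rcases subsingleton_or_nontrivial X with hX | hX
    · refine ⟨0, eq_smul_of_forall_smul_const Φ u T 0 fun a x => ?_⟩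
      rw [Subsingleton.elim (a • const K x) 0, smul_zero, map_zero, map_zero]
    obtain ⟨y, hy⟩ := exists_ne (0 : X)
    obtain ⟨xs, hxs⟩ := SeparatingDual.exists_eq_one (R := ℝ) hy
    set w : F := pairing Φ u xs (T (incl Φ u X (const K y))) with hw
    have hTw : ∀ (a : C(K, ℝ)) (x : X),
        T (incl Φ u X (a • const K x)) = a • mulVec Φ u x w := fun a x => by
      have e : pairC xs (const K y) = 1 := ContinuousMap.ext fun _ => hxs
      have := h a (incl Φ u X (const K y)) x xs
      rwa [pairing_incl, e, mulVec_emb, one_smul, smul_incl, ← hw] at this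
    -- `a u ↦ a w` is the bounded operator `⟨·, x*⟩ ∘ T ∘ (· y⃗)` on `F`.
    have hbound : ∀ a : C(K, ℝ),
        ‖Φ.act a w‖ ≤ ‖pairing Φ u xs ∘L T ∘L mulVec Φ u y‖ * ‖emb Φ u a‖ := fun a => by
      have e : Φ.act a w = (pairing Φ u xs ∘L T ∘L mulVec Φ u y) (emb Φ u a) := by
        change _ = pairing Φ u xs (T (mulVec Φ u y (emb Φ u a)))
        rw [mulVec_emb, hTw, ← mulVec_act, pairing_mulVec, hxs, one_smul]
      rw [e]
      exact ContinuousLinearMap.le_opNorm _ _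
    obtain ⟨c, hc⟩ := exists_emb_eq Φ u (y := w)
      ⟨_, abs_le_of_norm_act_le Φ u (norm_nonneg _) hbound⟩
    refine ⟨c, eq_smul_of_forall_smul_const Φ u T c fun a x => ?_⟩
    rw [hTw, ← hc, mulVec_emb, smul_incl, smul_comm]
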